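/- Let $(M,\mathcal B,\mu)$ be a probability space and let $f:M\to M$ be a measurable, measure-preserving transformation. Let $(X,d)$ be a metric space (with its Borel $\sigma$-algebra), let $\phi:M\to X^{\mathbb N}$, $\phi(x)=(\phi(x)_n)_{n\ge 0}$, be a measurable map, and put $$a_x(m,n)=d(\phi(x)_m,\phi(x)_n)\qquad (x\in M,\ 0\le m<n).$$ Assume that the family $a$ satisfies the hypotheses of Kingman's subadditive ergodic theorem, that is: each function $x\mapsto a_x(m,n)$ with $0\le m<n$ is measurable, and 1. $a_x(l,n)\le a_x(l,m)+a_x(m,n)$ for all $x\in M$ and all $0\le l<m<n$; 2. $a_x(m+1,n+1)=a_{f(x)}(m,n)$ for all $x\in M$ and all $0\le m<n$; 3. $\int_M|a_x(0,1)|\,d\mu(x)<+\infty$; 4. $\lim_{n\to+\infty}\int_M\frac{a_x(0,n)}{n}\,d\mu(x)>-\infty$. A sequence $(x_n)_{n\ge0}$ in $X$ *escapes linearly to infinity* if the limit $\lim_{n\to+\infty}d(x_0,x_n)/n$ exists and is positive and finite. For $\epsilon>0$ and $x,y\in X$ let $$[x,y]_\epsilon=\{z\in X: e^{-\epsilon}d(x,z)+d(z,y)\le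 d(x,y)\}.$$ A sequence $(x_n)_{n\ge0}$ in $X$ is *aligned* if for each $\epsilon>0$ there exists $K\in\mathbb N$ such that for infinitely many $n\in\mathbb N$ one has $x_k\in[x_0,x_n]_\epsilon$ for all $K\le k\le n$. Then for $\mu$-almost every $x\in M$: if the sequence $\phi(x)$ escapes linearly to infinity, then it is aligned. -/

import Mathlib

open Filter Topology MeasureTheory

/-- The integral of a real function with values in `[-∞, +∞]`: the integral of the positive part
minus the integral of the negative part (the value is `-∞` if the negative part has infinite
integral). For an integrable function it is the usual integral. -/
noncomputable def extIntegral {M : Type*} [MeasurableSpace M] (μ : Measure M) (g : M → ℝ) :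
    EReal :=
  ((∫⁻ x, ENNReal.ofReal (g x) ∂μ : ENNReal) : EReal) -
    ((∫⁻ x, ENNReal.ofReal (-g x) ∂μ : ENNReal) : EReal)

/-- The hypotheses of Kingman's subadditive ergodic theorem on a family `a m n : M → ℝ`, of which
only the members with `m < n` matter: `a m n x` is written `a_x(m, n)` in the usual notation. -/
structure KingmanHypotheses {M : Type*} [MeasurableSpace M] (μ : Measure M) (f : M → M)
    (a : ℕ → ℕ → M → ℝ) : Prop where
  measurable : ∀ m n : ℕ, m < n → Measurable (a m n)
  subadditive : ∀ (x : M) (l m n : ℕ), l < m → m < n → a l n x ≤ a l m x + a m n x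
  stationary : ∀ (x : M) (m n : ℕ), m < n → a (m + 1) (n + 1) x = a m n (f x)
  integrable : Integrable (a 0 1) μ
  /-- The time constant, i.e. the limit of the integrals of `a 0 n / n`, is not `-∞`. -/
  timeConstant : ∃ c : EReal, ⊥ < c ∧
    Tendsto (fun n : ℕ => extIntegral μ (fun x => a 0 n x / n)) atTop (𝓝 c)

/-- The sequence `u` has rate of escape `R`. -/
def HasRateOfEscape {X : Type*} [MetricSpace X] (u : ℕ → X) (R : ℝ) : Prop :=
  Tendsto (fun n : ℕ => dist (u 0) (u n) / n) atTop (𝓝 R)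

/-- The sequence `u` has a positive and finite rate of escape. -/
def EscapesLinearly {X : Type*} [MetricSpace X] (u : ℕ → X) : Prop :=
  ∃ R : ℝ, 0 < R ∧ HasRateOfEscape u R

/-- The `ε`-cone from `x` to `y`. -/
def epsCone {X : Type*} [MetricSpace X] (ε : ℝ) (x y : X) : Set X :=
  {z : X | Real.exp (-ε) * dist x z + dist z y ≤ dist x y}

/-- The sequence `u` is aligned: for every `ε > 0` there is `K` such that, for infinitely many `n`,
all the points `u k` with `K ≤ k ≤ n` lie in the `ε`-cone from `u 0` to `u n`. -/
def IsAligned {X : Type*} [MetricSpace X] (u : ℕ → X) : Prop :=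
  ∀ ε : ℝ, 0 < ε → ∃ K : ℕ,
    {n : ℕ | ∀ k : ℕ, K ≤ k → k ≤ n → u k ∈ epsCone ε (u 0) (u n)}.Infinite

/-! Fix `0 ≤ r < s` and let `B` be the set of points with speed at least `s` but without progress at
speed `r`. Both conditions hold up to a constant, so `B` is `f`-invariant and the restriction `ν` of
`μ` to `B` is preserved. By Riesz's leader lemma (`dist_le_add_sum_progressesTo`), only steps at
leaders push the distance above `r * n`. Integrated over `B` (`integral_min_le`), this bounds the
mean truncated distance by `r * ν(B)` plus a Cesàro mean of integrals over sets of points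
progressing up to time `i`. On `B` such times are finite in number, so that mean tends to `0`; hence
`s * ν(B) ≤ r * ν(B)` and `ν(B) = 0` (`ae_hasProgress`). Progress at rational speeds close to the
rate of escape then gives alignment (`HasRateOfEscape.isAligned`). -/

/-- Up to a constant, the distance of `u` to infinitely many of its points `u n` decreases at speed
at least `r` along the segment `u 0, …, u n`. -/
def HasProgress {X : Type*} [MetricSpace X] (r : ℝ) (u : ℕ → X) : Prop :=
  ∃ C : ℕ, ∃ᶠ n in atTop, ∀ k ≤ n, dist (u k) (u n) + r * k ≤ dist (u 0) (u n) + C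

/-- The sequence `u` moves away from its starting point at speed at least `r`, up to a constant. -/
def HasSpeedAtLeast {X : Type*} [MetricSpace X] (r : ℝ) (u : ℕ → X) : Prop :=
  ∃ C : ℕ, ∀ n : ℕ, r * n ≤ dist (u 0) (u n) + C

/-- At time `n` the sequence `u` has made progress at speed at least `r` towards `u n`, from its
start to each of its intermediate points. -/
def ProgressesTo {X : Type*} [MetricSpace X] (r : ℝ) (n : ℕ) (u : ℕ → X) : Prop :=
  ∀ k ≤ n, dist (u k) (u n) + r * k ≤ dist (u 0) (u n)

/-! ### Deterministic sequences: leaders, speed and alignment. -/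

section Sequences

variable {X : Type*} [MetricSpace X]

/-- Dropping the first point changes the inequalities by at most a multiple of `dist (u 0) (u 1)`
plus `|r|`, which the constant absorbs. This yields the invariance of the exceptional set. -/
theorem hasProgress_shift_iff {r : ℝ} (u : ℕ → X) :
    HasProgress r (fun n => u (n + 1)) ↔ HasProgress r u := by
  constructor
  · rintro ⟨C, hC⟩
    obtain ⟨D, hD⟩ := exists_nat_ge (C + |r| + 2 * dist (u 0) (u 1))
    refine ⟨D, ?_⟩
    rw [frequently_atTop] at hC ⊢
    intro N
    obtain ⟨n, hn, h⟩ := hC N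
    refine ⟨n + 1, by omega, fun k hk => ?_⟩
    have h1 := dist_triangle (u 1) (u 0) (u (n + 1))
    have h2 := dist_comm (u 1) (u 0)
    have h4 := abs_nonneg r
    have h5 : (0 : ℝ) ≤ C := C.cast_nonneg
    have h6 : (0 : ℝ) ≤ dist (u 0) (u 1) := dist_nonneg
    rcases k with _ | k
    · simp only [CharP.cast_eq_zero, mul_zero, add_zero]
      linarith
    · have h3 := h k (by omega)
      have h7 := le_abs_self r
      push_cast
      simp only [zero_add] at h3
      linarith
  · rintro ⟨C, hC⟩
    obtain ⟨D, hD⟩ := exists_nat_ge (C + |r| + dist (u 0) (u 1))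
    refine ⟨D, ?_⟩
    rw [frequently_atTop] at hC ⊢
    intro N
    obtain ⟨n, hn, h⟩ := hC (N + 1)
    obtain ⟨n, rfl⟩ : ∃ m, n = m + 1 := ⟨n - 1, by omega⟩
    refine ⟨n, by omega, fun k hk => ?_⟩
    have h1 := dist_triangle (u 0) (u 1) (u (n + 1))
    have h3 := h (k + 1) (by omega)
    have h7 := neg_abs_le r
    push_cast at h3
    simp only [zero_add]
    linarith

theorem hasSpeedAtLeast_shift_iff {r : ℝ} (u : ℕ → X) :
    HasSpeedAtLeast r (fun n => u (n + 1)) ↔ HasSpeedAtLeast r u := by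
  constructor
  · rintro ⟨C, hC⟩
    obtain ⟨D, hD⟩ := exists_nat_ge (C + |r| + dist (u 0) (u 1))
    refine ⟨D, fun n => ?_⟩
    have h4 := abs_nonneg r
    have h5 : (0 : ℝ) ≤ C := C.cast_nonneg
    have h6 : (0 : ℝ) ≤ dist (u 0) (u 1) := dist_nonneg
    rcases n with _ | n
    · have h8 : (0 : ℝ) ≤ dist (u 0) (u 0) := dist_nonneg
      simp only [CharP.cast_eq_zero, mul_zero]
      linarith
    · have h1 := dist_triangle (u 1) (u 0) (u (n + 1))
      have h2 := dist_comm (u 1) (u 0)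
      have h3 := hC n
      have h7 := le_abs_self r
      push_cast
      simp only [zero_add] at h3
      linarith
  · rintro ⟨C, hC⟩
    obtain ⟨D, hD⟩ := exists_nat_ge (C + |r| + dist (u 0) (u 1))
    refine ⟨D, fun n => ?_⟩
    have h1 := dist_triangle (u 0) (u 1) (u (n + 1))
    have h3 := hC (n + 1)
    have h7 := neg_abs_le r
    push_cast at h3
    simp only [zero_add]
    linarith

/-- A form of Riesz's lemma on leaders: only the steps from which `u` progresses to `u n` at speed
`r` can contribute to the excess of `dist (u 0) (u n)` over `r * n`. -/
theorem dist_le_add_sum_progressesTo {r : ℝ} (hr : 0 ≤ r) (u : ℕ → X) (n : ℕ)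
    [DecidablePred fun j => ProgressesTo r (n - j) (fun i => u (i + j))] :
    dist (u 0) (u n) ≤ r * n + ∑ j ∈ Finset.range n,
      if ProgressesTo r (n - j) (fun i => u (i + j)) then dist (u j) (u (j + 1)) else 0 := by
  set w : ℕ → ℝ := fun j =>
    if ProgressesTo r (n - j) (fun i => u (i + j)) then dist (u j) (u (j + 1)) else 0 with hw
  have hw0 : ∀ j, 0 ≤ w j := fun j => by
    simp only [hw]
    split_ifs <;> positivity
  suffices H : ∀ m j, m + j = n → dist (u j) (u n) ≤ r * m + ∑ i ∈ Finset.Ico j n, w i by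
    have := H n 0 (by omega)
    rwa [← Finset.range_eq_Ico] at this
  intro m
  induction m using Nat.strong_induction_on with
  | _ m ih =>
    intro j hj
    rcases Nat.eq_zero_or_pos m with rfl | hm
    · obtain rfl : j = n := by omega
      simp
    by_cases hgood : ProgressesTo r (n - j) (fun i => u (i + j))
    · have h1 := ih (m - 1) (by omega) (j + 1) (by omega)
      have h2 : w j = dist (u j) (u (j + 1)) := if_pos hgood
      rw [Finset.sum_eq_sum_Ico_succ_bot (show j < n by omega), h2]
      have h3 := dist_triangle (u j) (u (j + 1)) (u n)
      have h4 : r * ((m - 1 : ℕ) : ℝ) ≤ r * m :=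
        mul_le_mul_of_nonneg_left (by exact_mod_cast Nat.sub_le m 1) hr
      linarith
    -- If `j` is not a leader, a failing `k` gives `dist (u j) (u n) < dist (u (k + j)) (u n) + r *
    -- k`: jumping to `k + j` costs only `r * k`. The strictness excludes `k = 0`, so the induction
    -- descends.
    · simp only [ProgressesTo, not_forall, not_le, zero_add] at hgood
      obtain ⟨k, hk, h⟩ := hgood
      rw [show n - j + j = n by omega] at h
      have hk0 : k ≠ 0 := by
        rintro rfl
        simp at h
      have h1 := ih (m - k) (by omega) (k + j) (by omega)
      have h2 : ∑ i ∈ Finset.Ico (k + j) n, w i ≤ ∑ i ∈ Finset.Ico j n, w i :=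
        Finset.sum_le_sum_of_subset_of_nonneg
          (Finset.Ico_subset_Ico_left (by omega)) fun i _ _ => hw0 i
      rw [Nat.cast_sub (by omega : k ≤ m)] at h1
      linarith

theorem HasRateOfEscape.hasSpeedAtLeast {u : ℕ → X} {r R : ℝ} (hu : HasRateOfEscape u R)
    (hr : r < R) : HasSpeedAtLeast r u := by
  obtain ⟨N, hN⟩ := eventually_atTop.1 (hu.eventually (lt_mem_nhds hr))
  obtain ⟨C, hC⟩ := exists_nat_ge (|r| * N)
  refine ⟨C, fun n => ?_⟩
  have hd : 0 ≤ dist (u 0) (u n) := dist_nonneg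
  have hC0 : (0 : ℝ) ≤ C := C.cast_nonneg
  rcases lt_or_ge n N with h | h
  · have h1 : r * n ≤ |r| * n := mul_le_mul_of_nonneg_right (le_abs_self r) n.cast_nonneg
    have h2 : |r| * n ≤ |r| * N :=
      mul_le_mul_of_nonneg_left (by exact_mod_cast h.le) (abs_nonneg r)
    linarith
  · rcases Nat.eq_zero_or_pos n with rfl | hn
    · simp [hC0]
    · have h1 := (lt_div_iff₀ (by exact_mod_cast hn : (0 : ℝ) < n)).1 (hN n h)
      linarith

/-- Choose `q` strictly between `exp (-ε) * R` and `R`. For large `k`, `q * k` exceeds `exp (-ε) *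
dist (u 0) (u k) + C`, so progress at speed `q` implies the cone inequality. -/
theorem HasRateOfEscape.isAligned {u : ℕ → X} {R : ℝ} (hu : HasRateOfEscape u R)
    (hR : 0 < R) (h : ∀ q : ℚ, 0 ≤ (q : ℝ) → (q : ℝ) < R → HasProgress (q : ℝ) u) :
    IsAligned u := by
  intro ε hε
  have h1 : Real.exp (-ε) * R < R := by
    have : Real.exp (-ε) < 1 := Real.exp_zero ▸ Real.exp_lt_exp.2 (neg_lt_zero.2 hε)
    nlinarith
  obtain ⟨q, hq1, hq2⟩ := exists_rat_btwn h1
  obtain ⟨C, hC⟩ := h q (le_trans (by positivity) hq1.le) hq2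
  have hlim : Tendsto (fun n : ℕ => Real.exp (-ε) * (dist (u 0) (u n) / n) + C / (n : ℝ)) atTop
      (𝓝 (Real.exp (-ε) * R + 0)) :=
    (hu.const_mul _).add (tendsto_const_div_atTop_nhds_zero_nat _)
  rw [add_zero] at hlim
  obtain ⟨K, hK⟩ := eventually_atTop.1 (hlim.eventually (gt_mem_nhds hq1))
  refine ⟨K + 1, ?_⟩
  refine (Nat.frequently_atTop_iff_infinite.1 hC).mono fun n hn k hk hkn => ?_
  have hk0 : (0 : ℝ) < k := by exact_mod_cast (by omega : 0 < k)
  have h2 := hK k (by omega)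
  rw [← mul_div_assoc, ← add_div, div_lt_iff₀ hk0] at h2
  have h3 := hn k hkn
  change Real.exp (-ε) * dist (u 0) (u k) + dist (u k) (u n) ≤ dist (u 0) (u n)
  linarith

end Sequences

/-! ### Invariant sets and integration of the leader lemma. -/

section Dynamics

variable {M : Type*} [MeasurableSpace M] {μ : Measure M} {f : M → M}
  {X : Type*} [MetricSpace X] {φ : M → ℕ → X}

theorem KingmanHypotheses.measurable_dist
    (ha : KingmanHypotheses μ f (fun m n x => dist (φ x m) (φ x n))) (m n : ℕ) :
    Measurable fun x => dist (φ x m) (φ x n) := by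
  rcases lt_trichotomy m n with h | rfl | h
  · exact ha.measurable m n h
  · simp
  · simpa only [dist_comm] using ha.measurable n m h

theorem KingmanHypotheses.dist_apply
    (ha : KingmanHypotheses μ f (fun m n x => dist (φ x m) (φ x n))) (x : M) (m n : ℕ) :
    dist (φ (f x) m) (φ (f x) n) = dist (φ x (m + 1)) (φ x (n + 1)) := by
  rcases lt_trichotomy m n with h | rfl | h
  · exact (ha.stationary x m n h).symm
  · simp
  · rw [dist_comm, dist_comm (φ x (m + 1))]
    exact (ha.stationary x n m h).symm

theorem KingmanHypotheses.dist_iterate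
    (ha : KingmanHypotheses μ f (fun m n x => dist (φ x m) (φ x n))) (j : ℕ) (x : M) (m n : ℕ) :
    dist (φ (f^[j] x) m) (φ (f^[j] x) n) = dist (φ x (m + j)) (φ x (n + j)) := by
  induction j generalizing x with
  | zero => simp
  | succ j ih => rw [Function.iterate_succ_apply, ih, ha.dist_apply, add_assoc, add_assoc]

theorem KingmanHypotheses.hasProgress_apply_iff
    (ha : KingmanHypotheses μ f (fun m n x => dist (φ x m) (φ x n))) (r : ℝ) (x : M) :
    HasProgress r (φ (f x)) ↔ HasProgress r (φ x) := by
  rw [← hasProgress_shift_iff (φ x)]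
  simp only [HasProgress, ha.dist_apply]

theorem KingmanHypotheses.hasSpeedAtLeast_apply_iff
    (ha : KingmanHypotheses μ f (fun m n x => dist (φ x m) (φ x n))) (r : ℝ) (x : M) :
    HasSpeedAtLeast r (φ (f x)) ↔ HasSpeedAtLeast r (φ x) := by
  rw [← hasSpeedAtLeast_shift_iff (φ x)]
  simp only [HasSpeedAtLeast, ha.dist_apply]

theorem KingmanHypotheses.progressesTo_iterate_iff
    (ha : KingmanHypotheses μ f (fun m n x => dist (φ x m) (φ x n))) (r : ℝ) (n j : ℕ) (x : M) :
    ProgressesTo r n (φ (f^[j] x)) ↔ ProgressesTo r n (fun i => φ x (i + j)) := by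
  simp only [ProgressesTo, ha.dist_iterate]

theorem KingmanHypotheses.measurableSet_progressesTo
    (ha : KingmanHypotheses μ f (fun m n x => dist (φ x m) (φ x n))) (r : ℝ) (n : ℕ) :
    MeasurableSet {x | ProgressesTo r n (φ x)} := by
  simp only [ProgressesTo, Set.ofPred_forall]
  exact MeasurableSet.iInter fun k => MeasurableSet.iInter fun _ =>
    measurableSet_le ((ha.measurable_dist k n).add_const _) (ha.measurable_dist 0 n)

theorem KingmanHypotheses.measurableSet_hasProgress
    (ha : KingmanHypotheses μ f (fun m n x => dist (φ x m) (φ x n))) (r : ℝ) :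
    MeasurableSet {x | HasProgress r (φ x)} := by
  simp only [HasProgress, frequently_atTop, Set.ofPred_exists, Set.ofPred_forall, Set.ofPred_and]
  refine MeasurableSet.iUnion fun C => MeasurableSet.iInter fun N => MeasurableSet.iUnion fun n =>
    (MeasurableSet.const _).inter ?_
  exact MeasurableSet.iInter fun k => MeasurableSet.iInter fun _ =>
    measurableSet_le ((ha.measurable_dist k n).add_const _)
      ((ha.measurable_dist 0 n).add_const _)

theorem KingmanHypotheses.measurableSet_hasSpeedAtLeast
    (ha : KingmanHypotheses μ f (fun m n x => dist (φ x m) (φ x n))) (r : ℝ) :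
    MeasurableSet {x | HasSpeedAtLeast r (φ x)} := by
  simp only [HasSpeedAtLeast, Set.ofPred_exists, Set.ofPred_forall]
  exact MeasurableSet.iUnion fun C => MeasurableSet.iInter fun n =>
    measurableSet_le measurable_const ((ha.measurable_dist 0 n).add_const _)

theorem eventually_not_progressesTo {r : ℝ} {u : ℕ → X} (h : ¬ HasProgress r u) :
    ∀ᶠ n in atTop, ¬ ProgressesTo r n u := by
  by_contra H
  refine h ⟨0, (not_eventually.1 H).mono fun n hn => ?_⟩
  simpa [ProgressesTo] using hn

/-- Truncation at `r` turns a mere lower bound on the speed into a limit, and makes dominated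
convergence available. -/
theorem HasSpeedAtLeast.tendsto_min {r : ℝ} {u : ℕ → X} (h : HasSpeedAtLeast r u) :
    Tendsto (fun n : ℕ => min (dist (u 0) (u n) / n) r) atTop (𝓝 r) := by
  obtain ⟨C, hC⟩ := h
  have hlim : Tendsto (fun n : ℕ => r - (C : ℝ) / n) atTop (𝓝 (r - 0)) :=
    tendsto_const_nhds.sub (tendsto_const_div_atTop_nhds_zero_nat _)
  rw [sub_zero] at hlim
  refine tendsto_of_tendsto_of_tendsto_of_le_of_le' hlim tendsto_const_nhds ?_
    (Eventually.of_forall fun n => min_le_right _ _)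
  filter_upwards [eventually_gt_atTop 0] with n hn
  have hn' : (0 : ℝ) < n := by exact_mod_cast hn
  refine le_min ?_ (sub_le_self _ (by positivity))
  rw [sub_le_iff_le_add, ← add_div, le_div_iff₀ hn']
  exact hC n

/-- The truncated mean distance exceeds `r` by at most the average, over times `1 ≤ i ≤ n`, of the
integral of the first step over the set of points which progress at speed `r` up to time `i`. -/
theorem KingmanHypotheses.integral_min_le
    (ha : KingmanHypotheses μ f (fun m n x => dist (φ x m) (φ x n))) {ν : Measure M}
    [IsFiniteMeasure ν] (hνμ : ν ≤ μ) (hν : MeasurePreserving f ν ν) {r s : ℝ} (hr : 0 ≤ r)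
    (hs : 0 ≤ s) {n : ℕ} (hn : 0 < n) :
    ∫ x, min (dist (φ x 0) (φ x n) / n) s ∂ν ≤ r * ν.real Set.univ +
      (n : ℝ)⁻¹ * ∑ i ∈ Finset.range n, ∫ x,
        {y | ProgressesTo r (i + 1) (φ y)}.indicator (fun y => dist (φ y 0) (φ y 1)) x ∂ν := by
  classical
  have hn' : (0 : ℝ) < n := by exact_mod_cast hn
  set w : ℕ → M → ℝ := fun i =>
    {y | ProgressesTo r i (φ y)}.indicator (fun y => dist (φ y 0) (φ y 1)) with hw
  have hint : ∀ i, Integrable (w i) ν := fun i =>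
    (ha.integrable.mono_measure hνμ).indicator (ha.measurableSet_progressesTo r i)
  have hcomp : ∀ i j, Integrable (fun x => w i (f^[j] x)) ν := fun i j =>
    (hν.iterate j).integrable_comp_of_integrable (hint i)
  have hle : ∀ x, min (dist (φ x 0) (φ x n) / n) s ≤
      r + (n : ℝ)⁻¹ * ∑ j ∈ Finset.range n, w (n - j) (f^[j] x) := by
    intro x
    refine (min_le_left _ _).trans ?_
    have h1 := dist_le_add_sum_progressesTo hr (φ x) n
    have h2 : ∀ j, w (n - j) (f^[j] x) =
        if ProgressesTo r (n - j) (fun i => φ x (i + j)) then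
          dist (φ x j) (φ x (j + 1)) else 0 := by
      intro j
      simp only [hw, Set.indicator_apply, Set.mem_ofPred_eq, ha.progressesTo_iterate_iff,
        ha.dist_iterate, zero_add, add_comm 1 j]
    rw [Finset.sum_congr rfl fun j _ => h2 j, div_le_iff₀ hn', add_mul, mul_right_comm,
      inv_mul_cancel₀ hn'.ne', one_mul]
    exact h1
  have hmin : Integrable (fun x => min (dist (φ x 0) (φ x n) / n) s) ν := by
    refine Integrable.of_bound (C := s)
      (((ha.measurable_dist 0 n).div_const _).min measurable_const).aestronglyMeasurable
      (Eventually.of_forall fun x => ?_)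
    rw [Real.norm_of_nonneg (le_min (by positivity) hs)]
    exact min_le_right _ _
  have hsum : Integrable (fun x => ∑ j ∈ Finset.range n, w (n - j) (f^[j] x)) ν :=
    integrable_finsetSum _ fun j _ => hcomp _ _
  refine (integral_mono hmin ((integrable_const r).add (hsum.const_mul _)) hle).trans_eq ?_
  rw [integral_add' (integrable_const r) (hsum.const_mul _), integral_const, integral_const_mul,
    integral_finsetSum _ fun j _ => hcomp _ _, smul_eq_mul, mul_comm r]
  congr 2
  -- Reversing the order of summation indexes the terms by the remaining time `n - j`; invariance of
  -- `ν` then removes the iterates of `f`.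
  rw [← Finset.sum_range_reflect]
  refine Finset.sum_congr rfl fun j hj => ?_
  have hj' := Finset.mem_range.1 hj
  rw [show n - (n - 1 - j) = j + 1 by omega, ← integral_map (φ := f^[n - 1 - j]) (f := w (j + 1))
    (hν.iterate _).measurable.aemeasurable
    ((hν.iterate _).map_eq.symm ▸ (hint _).aestronglyMeasurable), (hν.iterate _).map_eq]

theorem KingmanHypotheses.ae_hasProgress [IsFiniteMeasure μ] (hf : MeasurePreserving f μ μ)
    (ha : KingmanHypotheses μ f (fun m n x => dist (φ x m) (φ x n))) {r s : ℝ} (hr : 0 ≤ r)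
    (hrs : r < s) : ∀ᵐ x ∂μ, HasSpeedAtLeast s (φ x) → HasProgress r (φ x) := by
  set B : Set M := {x | HasSpeedAtLeast s (φ x)} \ {x | HasProgress r (φ x)} with hB
  have hBm : MeasurableSet B :=
    (ha.measurableSet_hasSpeedAtLeast s).diff (ha.measurableSet_hasProgress r)
  have hBf : f ⁻¹' B = B := by
    ext x
    simp [hB, ha.hasSpeedAtLeast_apply_iff, ha.hasProgress_apply_iff]
  set ν := μ.restrict B with hνdef
  have hν : MeasurePreserving f ν ν := by
    have := hf.restrict_preimage hBm
    rwa [hBf] at this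
  have hmem : ∀ᵐ x ∂ν, x ∈ B := ae_restrict_mem hBm
  have h1 : Tendsto (fun n : ℕ => ∫ x, min (dist (φ x 0) (φ x n) / n) s ∂ν) atTop
      (𝓝 (∫ _, s ∂ν)) := by
    refine tendsto_integral_of_dominated_convergence (fun _ => s)
      (fun n => (((ha.measurable_dist 0 n).div_const _).min
        measurable_const).aestronglyMeasurable) (integrable_const s)
      (fun n => Eventually.of_forall fun x => ?_) ?_
    · rw [Real.norm_of_nonneg (le_min (by positivity) (hr.trans hrs.le))]
      exact min_le_right _ _
    · filter_upwards [hmem] with x hx using HasSpeedAtLeast.tendsto_min hx.1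
  have h2 : Tendsto (fun i : ℕ => ∫ x,
      {y | ProgressesTo r (i + 1) (φ y)}.indicator (fun y => dist (φ y 0) (φ y 1)) x ∂ν) atTop
      (𝓝 (∫ _, (0 : ℝ) ∂ν)) := by
    refine tendsto_integral_of_dominated_convergence (fun x => dist (φ x 0) (φ x 1))
      (fun i => ((ha.measurable_dist 0 1).indicator
        (ha.measurableSet_progressesTo r (i + 1))).aestronglyMeasurable)
      (ha.integrable.mono_measure Measure.restrict_le_self)
      (fun i => Eventually.of_forall fun x => ?_) ?_
    · refine (norm_indicator_le_norm_self _ _).trans_eq ?_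
      exact Real.norm_of_nonneg dist_nonneg
    · filter_upwards [hmem] with x hx
      refine tendsto_const_nhds.congr' ?_
      filter_upwards [(tendsto_add_atTop_nat 1).eventually (eventually_not_progressesTo hx.2)]
        with i hi
      exact (Set.indicator_of_notMem hi _).symm
  rw [integral_zero] at h2
  have h3 : ∫ _, s ∂ν ≤ r * ν.real Set.univ + 0 := by
    -- The integrals in `h2` tend to `0`, hence so do their Cesàro means.
    refine le_of_tendsto_of_tendsto h1 (tendsto_const_nhds.add h2.cesaro) ?_
    filter_upwards [eventually_gt_atTop 0] with n hn
    exact ha.integral_min_le Measure.restrict_le_self hν hr (hr.trans hrs.le) hn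
  rw [integral_const, smul_eq_mul] at h3
  have h4 : ν.real Set.univ = 0 := by
    have : 0 ≤ ν.real Set.univ := measureReal_nonneg
    nlinarith
  have h5 : μ B = 0 := by
    rwa [measureReal_eq_zero_iff, hνdef, Measure.restrict_apply_univ] at h4
  filter_upwards [measure_eq_zero_iff_ae_notMem.1 h5] with x hx hxs
  by_contra hxr
  exact hx ⟨hxs, hxr⟩

end Dynamics

theorem mainTheorem2 {M : Type*} [MeasurableSpace M] (μ : Measure M) [IsProbabilityMeasure μ]
    (f : M → M) (hf : MeasurePreserving f μ μ)
    {X : Type*} [MetricSpace X] [MeasurableSpace X] [BorelSpace X]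
    (φ : M → ℕ → X) (hφ : Measurable φ)
    (ha : KingmanHypotheses μ f (fun m n x => dist (φ x m) (φ x n))) :
    ∀ᵐ x ∂μ, EscapesLinearly (φ x) → IsAligned (φ x) := by
  -- The rate of escape may depend on `x`; rational speeds keep the exceptional sets countable in
  -- number.
  have h : ∀ᵐ x ∂μ, ∀ q s : ℚ, 0 ≤ (q : ℝ) → (q : ℝ) < s → HasSpeedAtLeast (s : ℝ) (φ x) →
      HasProgress (q : ℝ) (φ x) := by
    refine ae_all_iff.2 fun q => ae_all_iff.2 fun s => ?_
    by_cases hq : 0 ≤ (q : ℝ) ∧ (q : ℝ) < s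
    · filter_upwards [ha.ae_hasProgress hf hq.1 hq.2] with x hx _ _ using hx
    · exact Eventually.of_forall fun x h1 h2 => absurd ⟨h1, h2⟩ hq
  filter_upwards [h] with x hx
  rintro ⟨R, hR, hxR⟩
  refine hxR.isAligned hR fun q hq0 hqR => ?_
  obtain ⟨s, hqs, hsR⟩ := exists_rat_btwn hqR
  exact hx q s hq0 hqs (hxR.hasSpeedAtLeast hsR)
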